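/- Let $A\in\mathbb R^{n_x\times n_x}$, $B\in\mathbb R^{n_x\times n_u}$, $Q\in\mathbb R^{n_x\times n_x}$, $R\in\mathbb R^{n_u\times n_u}$, $S\in\mathbb R^{n_u\times n_x}$ with $\begin{bmatrix}Q&S^\top\\ S&R\end{bmatrix}\succ0$, and let $(w_t)_{t\ge0}$ be square-integrable random vectors in $\mathbb R^{n_x}$ with $\mathbb E w_t=0$, $\mathbb E w_tw_t^\top=I$ and $\mathbb E w_sw_t^\top=0$ for $s\ne t$ (for example i.i.d.). Consider $x_{t+1}=Ax_t+Bu_t+w_t$, $x_0=0$, with the average cost $$C=\lim_{T\to\infty}\frac1T\,\mathbb E\sum_{t=0}^{T-1}\left(x_t^\top Qx_t+u_t^\top Ru_t+2u_t^\top Sx_t\right).$$ Write $C(K)$ for the cost of the state feedback $u_t=Kx_t$, and $C(L^{(H)})$ for the cost of the $H$-order disturbance response controller (DRC) $u_t=L^{(H)}_1w_{t-1}+\dots+L^{(H)}_Hw_{t-H}$, where $w_s=0$ for $s<0$. Let $K_\star=-(R+B^\top PB)^{-1}(B^\top PA+S)$ be the optimal LQR gain, where $P\succeq0$ solves the Riccati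 equation $P=A^\top PA-(A^\top PB+S^\top)(R+B^\top PB)^{-1}(B^\top PA+S)+Q$. Let $\|\cdot\|$ be the matrix $\ell_2$ (spectral) norm, and suppose that for some $\tau\in\mathbb R$ and $\rho>0$ both $A$ and $A+BK_\star$ are $(\tau,e^{-\rho})$-stable, that is, $\|A^k\|\le\tau e^{-\rho k}$ and $\|(A+BK_\star)^k\|\le\tau e^{-\rho k}$ for all integers $k\ge0$. Then the limit defining $C(K_\star)$ exists. For every $H\ge0$ the limit defining $C(L^{(H)})$ exists for every $H$-order DRC, a minimizer of $C$ over the $H$-order DRCs exists, and every minimizer $L_\star^{(H)}$ satisfies $$0\le C(L_\star^{(H)})-C(K_\star)\le n_x^2e^{-2\rho H}\left(\|R\|+\frac{4\tau^4\left(\|B\|\|K_\star\|^2+\|K_\star\|\right)\left(\|B\|\|Q\|+\|S\|\right)}{(1-e^{-2\rho})^3}\right).$$ In particular, the optimal $H$-order DRC cost approaches the optimal LQR cost exponentially fast in $H$. -/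

import Mathlib

open scoped Matrix.Norms.L2Operator

/-- `M` is `(τ, γ)`-stable: `‖M ^ k‖ ≤ τ γ ^ k` for all `k`, in the spectral (ℓ²-operator) norm. -/
def IsTauStable {n : ℕ} (τ γ : ℝ) (M : Matrix (Fin n) (Fin n) ℝ) : Prop :=
  ∀ k : ℕ, ‖M ^ k‖ ≤ τ * γ ^ k

/-- Second-order white noise: square integrable, zero mean, identity covariance, uncorrelated
in time. In particular i.i.d. sequences of zero mean and identity covariance qualify. -/
structure IsStandardNoise {Ω : Type*} [MeasurableSpace Ω] (μ : MeasureTheory.Measure Ω) {n : ℕ}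
    (w : ℕ → Ω → Fin n → ℝ) : Prop where
  memLp : ∀ t i, MeasureTheory.MemLp (fun ω => w t ω i) 2 μ
  mean : ∀ t i, ∫ ω, w t ω i ∂μ = 0
  cov : ∀ s t i j, ∫ ω, w s ω i * w t ω j ∂μ = if s = t ∧ i = j then 1 else 0

/-- The data of a linear quadratic regulator problem with `n` states and `m` inputs. -/
structure LQRSystem (n m : ℕ) where
  A : Matrix (Fin n) (Fin n) ℝ
  B : Matrix (Fin n) (Fin m) ℝ
  Q : Matrix (Fin n) (Fin n) ℝ
  R : Matrix (Fin m) (Fin m) ℝ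
  S : Matrix (Fin m) (Fin n) ℝ

namespace LQRSystem

open Matrix

variable {n m : ℕ}

/-- The weight `[[Q, Sᵀ], [S, R]]` of the quadratic stage cost. -/
def weight (sys : LQRSystem n m) : Matrix (Fin n ⊕ Fin m) (Fin n ⊕ Fin m) ℝ :=
  Matrix.fromBlocks sys.Q sys.Sᵀ sys.S sys.R

/-- The stage cost `xᵀ Q x + uᵀ R u + 2 uᵀ S x`. -/
def stageCost (sys : LQRSystem n m) (x : Fin n → ℝ) (u : Fin m → ℝ) : ℝ :=
  x ⬝ᵥ (sys.Q *ᵥ x) + u ⬝ᵥ (sys.R *ᵥ u) + 2 * (u ⬝ᵥ (sys.S *ᵥ x))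

/-- The trajectory `x 0 = 0`, `x (t + 1) = A x t + B u t + w t` under an input sequence `u`. -/
def state (sys : LQRSystem n m) (u : ℕ → Fin m → ℝ) (w : ℕ → Fin n → ℝ) : ℕ → Fin n → ℝ
  | 0 => 0
  | t + 1 => sys.A *ᵥ sys.state u w t + sys.B *ᵥ u t + w t

/-- The closed-loop trajectory under state feedback `u t = K x t`, started at `x 0 = 0`. -/
def feedbackState (sys : LQRSystem n m) (K : Matrix (Fin m) (Fin n) ℝ) (w : ℕ → Fin n → ℝ) :
    ℕ → Fin n → ℝ
  | 0 => 0
  | t + 1 => sys.A *ᵥ sys.feedbackState K w t + sys.B *ᵥ (K *ᵥ sys.feedbackState K w t) + w t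

/-- The input `u t = L₁ w (t - 1) + ⋯ + L_H w (t - H)` of an `H`-order disturbance response
controller, with `w s = 0` for `s < 0`. The entry `L h`, for `h : Fin H`, is `L_{h + 1}`. -/
def drcInput {H : ℕ} (L : Fin H → Matrix (Fin m) (Fin n) ℝ) (w : ℕ → Fin n → ℝ) (t : ℕ) :
    Fin m → ℝ :=
  ∑ h : Fin H, if (h : ℕ) + 1 ≤ t then L h *ᵥ w (t - ((h : ℕ) + 1)) else 0

variable {Ω : Type*} [MeasurableSpace Ω]

/-- The expected average cost over the first `T` steps under state feedback `K`. -/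
noncomputable def feedbackAvgCost (sys : LQRSystem n m) (μ : MeasureTheory.Measure Ω)
    (w : ℕ → Ω → Fin n → ℝ) (K : Matrix (Fin m) (Fin n) ℝ) (T : ℕ) : ℝ :=
  (1 / (T : ℝ)) * ∫ ω, ∑ t ∈ Finset.range T,
    sys.stageCost (sys.feedbackState K (fun s => w s ω) t)
      (K *ᵥ sys.feedbackState K (fun s => w s ω) t) ∂μ

/-- The expected average cost over the first `T` steps under the controller `L`. -/
noncomputable def drcAvgCost (sys : LQRSystem n m) (μ : MeasureTheory.Measure Ω)
    (w : ℕ → Ω → Fin n → ℝ) {H : ℕ} (L : Fin H → Matrix (Fin m) (Fin n) ℝ) (T : ℕ) : ℝ :=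
  (1 / (T : ℝ)) * ∫ ω, ∑ t ∈ Finset.range T,
    sys.stageCost (sys.state (drcInput L (fun s => w s ω)) (fun s => w s ω) t)
      (drcInput L (fun s => w s ω) t) ∂μ

/-- The infinite-horizon average cost `C(K)`. -/
noncomputable def feedbackCost (sys : LQRSystem n m) (μ : MeasureTheory.Measure Ω)
    (w : ℕ → Ω → Fin n → ℝ) (K : Matrix (Fin m) (Fin n) ℝ) : ℝ :=
  Filter.limUnder Filter.atTop (sys.feedbackAvgCost μ w K)

/-- The infinite-horizon average cost `C(L)`. -/
noncomputable def drcCost (sys : LQRSystem n m) (μ : MeasureTheory.Measure Ω)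
    (w : ℕ → Ω → Fin n → ℝ) {H : ℕ} (L : Fin H → Matrix (Fin m) (Fin n) ℝ) : ℝ :=
  Filter.limUnder Filter.atTop (sys.drcAvgCost μ w L)

/-- `L` minimizes the infinite-horizon average cost over all controllers of its order. -/
def IsOptimalDRC (sys : LQRSystem n m) (μ : MeasureTheory.Measure Ω)
    (w : ℕ → Ω → Fin n → ℝ) {H : ℕ} (L : Fin H → Matrix (Fin m) (Fin n) ℝ) : Prop :=
  ∀ L' : Fin H → Matrix (Fin m) (Fin n) ℝ, sys.drcCost μ w L ≤ sys.drcCost μ w L'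

/-- `P` is a positive semidefinite solution of the discrete algebraic Riccati equation
`P = Aᵀ P A - (Aᵀ P B + Sᵀ) (R + Bᵀ P B)⁻¹ (Bᵀ P A + S) + Q`. -/
def IsCostToGo (sys : LQRSystem n m) (P : Matrix (Fin n) (Fin n) ℝ) : Prop :=
  P.PosSemidef ∧
    P = sys.Aᵀ * P * sys.A
      - (sys.Aᵀ * P * sys.B + sys.Sᵀ) * (sys.R + sys.Bᵀ * P * sys.B)⁻¹
        * (sys.Bᵀ * P * sys.A + sys.S) + sys.Q

/-- The LQR gain `-(R + Bᵀ P B)⁻¹ (Bᵀ P A + S)` attached to `P`. -/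
noncomputable def gain (sys : LQRSystem n m) (P : Matrix (Fin n) (Fin n) ℝ) :
    Matrix (Fin m) (Fin n) ℝ :=
  -((sys.R + sys.Bᵀ * P * sys.B)⁻¹ * (sys.Bᵀ * P * sys.A + sys.S))

end LQRSystem

/-! ### Traces, spectral norms and positive definite forms. -/

section MatrixFacts

open Matrix

/-! Under either kind of controller, state and input are causal linear filters of the noise, with
matrix impulse responses `X i` and `U i`. White noise kills the cross terms, so the expected stage
cost at time `t` is the `t`-th partial sum of `∑ matrixCost (X i) (U i)`. By Cesàro, the average
cost is the sum of this series (`tendsto_average_stageCost`).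

Lower bound: completing the square with the Riccati equation (`IsCostToGo.matrixCost_eq`) turns each
term into a telescoping difference of `tr (Xᵀ P X)` plus a nonnegative square of `U - K X`. As `X 0
= 1`, a series with decaying state response sums to at least `tr P`, with equality when `U = K X`.

Upper bound: put `C = A + B K` and truncate the optimal feedback, taking `L_{h+1} = K C ^ h` for `h
< H`. The two series agree on their first `H` terms. Afterwards the states are `A ^ k C ^ H` and `C
^ (k + H)`, both of size `O(r ^ (k + H))` with `r = e^{-ρ}`. Their difference is a sum of `k` terms,
each with a factor `A - C = -B K`. The costs are quadratic, so the excess is of order `r ^ (2H)`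
times convergent series in `k r ^ (2k)` and `r ^ (2k)`.

A minimizer exists because the limit cost is continuous and coercive in the finitely many entries of
`L`. -/

theorem Matrix.trace_transpose_mul_mul_eq_sum {ι κ ν : Type*} [Fintype ι] [Fintype κ] [Fintype ν]
    (X : Matrix ι ν ℝ) (W : Matrix ι κ ℝ) (Y : Matrix κ ν ℝ) :
    (Xᵀ * W * Y).trace = ∑ j, Xᵀ j ⬝ᵥ (W *ᵥ Yᵀ j) := by
  refine Finset.sum_congr rfl fun j _ => ?_
  rw [Matrix.mul_assoc, diag_apply, mul_apply]
  rfl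

theorem Matrix.l2_opNorm_transpose {m n : ℕ} (X : Matrix (Fin m) (Fin n) ℝ) : ‖Xᵀ‖ = ‖X‖ := by
  rw [← conjTranspose_eq_transpose_of_trivial, l2_opNorm_conjTranspose]

theorem Matrix.abs_entry_le_l2_opNorm {n : ℕ} (M : Matrix (Fin n) (Fin n) ℝ) (i : Fin n) :
    |M i i| ≤ ‖M‖ := by
  have h := l2_opNorm_mulVec M (EuclideanSpace.single i (1 : ℝ))
  rw [PiLp.norm_single, norm_one, mul_one] at h
  refine le_trans ?_ h
  refine le_trans (le_of_eq ?_) (PiLp.norm_apply_le _ i)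
  simp [Real.norm_eq_abs]

theorem Matrix.trace_le_card_mul_l2_opNorm {n : ℕ} (M : Matrix (Fin n) (Fin n) ℝ) :
    M.trace ≤ n * ‖M‖ := by
  calc M.trace ≤ ∑ _i : Fin n, ‖M‖ :=
        Finset.sum_le_sum fun i _ => (le_abs_self _).trans (M.abs_entry_le_l2_opNorm i)
    _ = n * ‖M‖ := by simp

theorem Matrix.l2_opNorm_transpose_mul_mul_le {m n k : ℕ} (X : Matrix (Fin m) (Fin k) ℝ)
    (W : Matrix (Fin m) (Fin n) ℝ) (Y : Matrix (Fin n) (Fin k) ℝ) :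
    ‖Xᵀ * W * Y‖ ≤ ‖X‖ * ‖W‖ * ‖Y‖ := by
  refine (l2_opNorm_mul _ _).trans (mul_le_mul_of_nonneg_right ?_ (norm_nonneg _))
  rw [← X.l2_opNorm_transpose]
  exact l2_opNorm_mul _ _

theorem Matrix.trace_transpose_mul_mul_le {m n k : ℕ} (X : Matrix (Fin m) (Fin k) ℝ)
    (W : Matrix (Fin m) (Fin n) ℝ) (Y : Matrix (Fin n) (Fin k) ℝ) :
    (Xᵀ * W * Y).trace ≤ k * (‖X‖ * ‖W‖ * ‖Y‖) :=
  (trace_le_card_mul_l2_opNorm _).trans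
    (mul_le_mul_of_nonneg_left (l2_opNorm_transpose_mul_mul_le X W Y) (Nat.cast_nonneg _))

/-- The quadratic form of a positive definite matrix dominates the squared coordinates. -/
theorem Matrix.PosDef.exists_sq_le_dotProduct_mulVec {ι : Type*} [Fintype ι] {W : Matrix ι ι ℝ}
    (hW : W.PosDef) : ∃ ε > 0, ∀ x i, ε * x i ^ 2 ≤ x ⬝ᵥ (W *ᵥ x) := by
  have hcont : Continuous fun x : ι → ℝ => x ⬝ᵥ (W *ᵥ x) := by fun_prop
  have hpos : ∀ x : ι → ℝ, x ≠ 0 → 0 < x ⬝ᵥ (W *ᵥ x) := fun x hx => by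
    simpa using hW.dotProduct_mulVec_pos hx
  by_cases hne : (Metric.sphere (0 : ι → ℝ) 1).Nonempty
  · obtain ⟨z, hz, hmin⟩ := (isCompact_sphere (0 : ι → ℝ) 1).exists_isMinOn hne hcont.continuousOn
    have hz0 : z ≠ 0 := by
      rintro rfl
      simp at hz
    refine ⟨_, hpos z hz0, fun x i => ?_⟩
    by_cases hx : x = 0
    · simp [hx]
    have hnx : 0 < ‖x‖ := norm_pos_iff.2 hx
    have h := hmin (a := ‖x‖⁻¹ • x) (by simp [norm_smul, hnx.ne'])
    simp only [Set.mem_ofPred_eq, mulVec_smul, dotProduct_smul, smul_dotProduct, smul_eq_mul] at h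
    have h2 : x i ^ 2 ≤ ‖x‖ ^ 2 := by
      rw [← sq_abs]
      exact pow_le_pow_left₀ (abs_nonneg _) (norm_le_pi_norm x i) 2
    calc _ ≤ z ⬝ᵥ (W *ᵥ z) * ‖x‖ ^ 2 := mul_le_mul_of_nonneg_left h2 (hpos z hz0).le
      _ ≤ ‖x‖⁻¹ * (‖x‖⁻¹ * x ⬝ᵥ (W *ᵥ x)) * ‖x‖ ^ 2 := mul_le_mul_of_nonneg_right h (by positivity)
      _ = x ⬝ᵥ (W *ᵥ x) := by field_simp
  · classical
    refine ⟨1, one_pos, fun x i => ?_⟩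
    -- An empty sphere means an empty index type, since any index `i` would give a unit vector.
    exact absurd ⟨Pi.single i 1, by simp [Pi.norm_single]⟩ hne

/-- A difference of powers as a sum over the position of the first differing factor. -/
theorem pow_sub_pow_eq_sum {R : Type*} [Ring R] (a b : R) (k : ℕ) :
    a ^ k - b ^ k = ∑ l ∈ Finset.range k, a ^ (k - 1 - l) * (a - b) * b ^ l := by
  have h := Finset.sum_range_sub' (fun l => a ^ (k - l) * b ^ l) k
  simp only [Nat.sub_zero, pow_zero, mul_one, Nat.sub_self, one_mul] at h
  rw [← h]
  refine Finset.sum_congr rfl fun l hl => ?_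
  have hl' := Finset.mem_range.1 hl
  rw [show k - l = (k - 1 - l) + 1 by omega, show k - (l + 1) = k - 1 - l by omega, pow_succ a,
    pow_succ' b]
  noncomm_ring

end MatrixFacts

/-! ### Geometric decay of powers of stable matrices. -/

namespace IsTauStable

open Matrix

variable {n : ℕ} {τ r : ℝ} {M N : Matrix (Fin n) (Fin n) ℝ}

theorem nonneg (h : IsTauStable τ r M) : 0 ≤ τ := by
  simpa using (norm_nonneg _).trans (h 0)

/-- Matches the factor `τ ^ 2` that bounds a product `A ^ k * C ^ H`. The case `k = 0` of stability
is used instead of `1 ≤ τ`, which can fail when `n = 0`. -/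
theorem norm_pow_le_sq_mul (h : IsTauStable τ r M) (k : ℕ) : ‖M ^ k‖ ≤ τ ^ 2 * r ^ k := by
  have h0 : ‖(1 : Matrix (Fin n) (Fin n) ℝ)‖ ≤ τ := by simpa using h 0
  calc ‖M ^ k‖ = ‖1 * M ^ k‖ := by rw [one_mul]
    _ ≤ τ * (τ * r ^ k) :=
        (norm_mul_le _ _).trans (mul_le_mul h0 (h k) (norm_nonneg _) h.nonneg)
    _ = τ ^ 2 * r ^ k := by ring

theorem summable_transpose_mul_mul (h : IsTauStable τ r M) (hr0 : 0 ≤ r) (hr1 : r < 1)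
    (W : Matrix (Fin n) (Fin n) ℝ) : Summable fun k : ℕ => (M ^ k)ᵀ * W * M ^ k := by
  have hg : Summable fun k : ℕ => τ ^ 2 * ‖W‖ * (r ^ 2) ^ k :=
    (summable_geometric_of_lt_one (by positivity) (by nlinarith)).mul_left _
  refine hg.of_norm_bounded fun k => (l2_opNorm_transpose_mul_mul_le _ _ _).trans ?_
  have hk : 0 ≤ τ * r ^ k := mul_nonneg h.nonneg (pow_nonneg hr0 _)
  calc ‖M ^ k‖ * ‖W‖ * ‖M ^ k‖ ≤ (τ * r ^ k) * ‖W‖ * (τ * r ^ k) :=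
        mul_le_mul (mul_le_mul_of_nonneg_right (h k) (norm_nonneg _)) (h k) (norm_nonneg _)
          (mul_nonneg hk (norm_nonneg _))
    _ = τ ^ 2 * ‖W‖ * (r ^ 2) ^ k := by ring

theorem hasSum_trace (h : IsTauStable τ r M) (hr0 : 0 ≤ r) (hr1 : r < 1)
    (W Y : Matrix (Fin n) (Fin n) ℝ) :
    HasSum (fun k : ℕ => ((M ^ k * Y)ᵀ * W * (M ^ k * Y)).trace)
      (Yᵀ * (∑' k : ℕ, (M ^ k)ᵀ * W * M ^ k) * Y).trace := by
  have h1 := ((h.summable_transpose_mul_mul hr0 hr1 W).hasSum.mul_left Yᵀ).mul_right Y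
  have h2 := h1.map (traceAddMonoidHom (Fin n) ℝ) continuous_id.matrix_trace
  refine h2.congr_fun fun k => ?_
  simp only [Function.comp_apply, traceAddMonoidHom_apply, transpose_mul, Matrix.mul_assoc]

/-- Each term of the telescoped difference carries `k - 1 + H` powers; the factor `r` on the left
avoids the exponent `k - 1`, which is truncated at `k = 0`. -/
theorem norm_pow_sub_pow_mul_pow_le (hM : IsTauStable τ r M) (hN : IsTauStable τ r N)
    (hr0 : 0 ≤ r) (k H : ℕ) :
    r * ‖(M ^ k - N ^ k) * N ^ H‖ ≤ k * (τ ^ 2 * ‖M - N‖ * r ^ (k + H)) := by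
  rw [pow_sub_pow_eq_sum, Finset.sum_mul]
  have hterm : ∀ l ∈ Finset.range k,
      r * ‖M ^ (k - 1 - l) * (M - N) * N ^ l * N ^ H‖ ≤ τ ^ 2 * ‖M - N‖ * r ^ (k + H) := by
    intro l hl
    have hl' := Finset.mem_range.1 hl
    have hk : r ^ (k + H) = r * (r ^ (k - 1 - l) * r ^ (l + H)) := by
      rw [← pow_add, ← pow_succ']
      congr 1
      omega
    have h1 : ‖M ^ (k - 1 - l) * (M - N) * N ^ (l + H)‖
        ≤ τ * r ^ (k - 1 - l) * ‖M - N‖ * (τ * r ^ (l + H)) := by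
      refine (norm_mul_le _ _).trans (mul_le_mul ((norm_mul_le _ _).trans
        (mul_le_mul_of_nonneg_right (hM _) (norm_nonneg _))) (hN _) (norm_nonneg _) ?_)
      exact mul_nonneg (mul_nonneg hM.nonneg (pow_nonneg hr0 _)) (norm_nonneg _)
    rw [mul_assoc _ (N ^ l), ← pow_add]
    calc _ ≤ r * (τ * r ^ (k - 1 - l) * ‖M - N‖ * (τ * r ^ (l + H))) :=
          mul_le_mul_of_nonneg_left h1 hr0
      _ = _ := by rw [hk]; ring
  calc _ ≤ r * ∑ l ∈ Finset.range k, ‖M ^ (k - 1 - l) * (M - N) * N ^ l * N ^ H‖ :=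
        mul_le_mul_of_nonneg_left (norm_sum_le _ _) hr0
    _ ≤ ∑ _l ∈ Finset.range k, τ ^ 2 * ‖M - N‖ * r ^ (k + H) := by
        rw [Finset.mul_sum]
        exact Finset.sum_le_sum hterm
    _ = _ := by simp

end IsTauStable

/-! ### Second moments of filtered white noise. -/

section WhiteNoise

open Matrix MeasureTheory

variable {Ω : Type*} [MeasurableSpace Ω] {μ : Measure Ω} {n : ℕ} {w : ℕ → Ω → Fin n → ℝ}

theorem IsStandardNoise.integrable_mul (hw : IsStandardNoise μ w) (s t : ℕ) (i j : Fin n) :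
    Integrable (fun ω => w s ω i * w t ω j) μ :=
  (hw.memLp s i).integrable_mul (hw.memLp t j)

theorem dotProduct_mulVec_eq_sum (N : Matrix (Fin n) (Fin n) ℝ) (x y : Fin n → ℝ) :
    x ⬝ᵥ (N *ᵥ y) = ∑ i, ∑ j, N i j * (x i * y j) := by
  simp only [dotProduct, mulVec, Finset.mul_sum]
  exact Finset.sum_congr rfl fun i _ => Finset.sum_congr rfl fun j _ => by ring

theorem IsStandardNoise.integrable_dotProduct_mulVec (hw : IsStandardNoise μ w)
    (N : Matrix (Fin n) (Fin n) ℝ) (s t : ℕ) :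
    Integrable (fun ω => w s ω ⬝ᵥ (N *ᵥ w t ω)) μ := by
  simp only [dotProduct_mulVec_eq_sum]
  exact integrable_finsetSum _ fun i _ => integrable_finsetSum _ fun j _ =>
    (hw.integrable_mul s t i j).const_mul _

theorem IsStandardNoise.integral_dotProduct_mulVec (hw : IsStandardNoise μ w)
    (N : Matrix (Fin n) (Fin n) ℝ) (s t : ℕ) :
    ∫ ω, w s ω ⬝ᵥ (N *ᵥ w t ω) ∂μ = if s = t then N.trace else 0 := by
  simp only [dotProduct_mulVec_eq_sum]
  rw [integral_finsetSum _ fun i _ => integrable_finsetSum _ fun j _ =>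
    (hw.integrable_mul s t i j).const_mul (N i j)]
  have h : ∀ i, ∫ ω, ∑ j, N i j * (w s ω i * w t ω j) ∂μ = if s = t then N i i else 0 := by
    intro i
    rw [integral_finsetSum _ fun j _ => (hw.integrable_mul s t i j).const_mul (N i j)]
    simp only [integral_const_mul, hw.cov]
    by_cases hst : s = t <;> simp [hst]
  simp only [h]
  by_cases hst : s = t <;> simp [hst, Matrix.trace]

/-- The response `∑ F i w (t - 1 - i)` of a linear filter `F` to the noise `w`. -/
def filterResponse {a : ℕ} (F : ℕ → Matrix (Fin a) (Fin n) ℝ) (w : ℕ → Fin n → ℝ) (t : ℕ) :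
    Fin a → ℝ :=
  ∑ i ∈ Finset.range t, F i *ᵥ w (t - (i + 1))

variable {a b : ℕ} (F : ℕ → Matrix (Fin a) (Fin n) ℝ) (G : ℕ → Matrix (Fin b) (Fin n) ℝ)
  (W : Matrix (Fin a) (Fin b) ℝ)

theorem filterResponse_dotProduct_mulVec (w : ℕ → Fin n → ℝ) (t : ℕ) :
    filterResponse F w t ⬝ᵥ (W *ᵥ filterResponse G w t)
      = ∑ i ∈ Finset.range t, ∑ j ∈ Finset.range t,
        w (t - (i + 1)) ⬝ᵥ (((F i)ᵀ * W * G j) *ᵥ w (t - (j + 1))) := by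
  rw [filterResponse, filterResponse, mulVec_sum, sum_dotProduct]
  refine Finset.sum_congr rfl fun i _ => ?_
  rw [dotProduct_sum]
  refine Finset.sum_congr rfl fun j _ => ?_
  rw [← mulVec_mulVec, ← mulVec_mulVec, dotProduct_mulVec (w _), vecMul_transpose]

theorem IsStandardNoise.integrable_filterResponse (hw : IsStandardNoise μ w) (t : ℕ) :
    Integrable (fun ω => filterResponse F (fun s => w s ω) t
      ⬝ᵥ (W *ᵥ filterResponse G (fun s => w s ω) t)) μ := by
  simp only [filterResponse_dotProduct_mulVec]
  exact integrable_finsetSum _ fun i _ => integrable_finsetSum _ fun j _ =>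
    hw.integrable_dotProduct_mulVec _ _ _

/-- Noises at different times are uncorrelated, so only the diagonal of the double sum survives, and
identity covariance turns each diagonal term into a trace. -/
theorem IsStandardNoise.integral_filterResponse (hw : IsStandardNoise μ w) (t : ℕ) :
    ∫ ω, filterResponse F (fun s => w s ω) t ⬝ᵥ (W *ᵥ filterResponse G (fun s => w s ω) t) ∂μ
      = ∑ i ∈ Finset.range t, ((F i)ᵀ * W * G i).trace := by
  simp only [filterResponse_dotProduct_mulVec]
  rw [integral_finsetSum _ fun i _ => integrable_finsetSum _ fun j _ =>
    hw.integrable_dotProduct_mulVec _ _ _]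
  refine Finset.sum_congr rfl fun i hi => ?_
  rw [integral_finsetSum _ fun j _ => hw.integrable_dotProduct_mulVec _ _ _]
  simp only [hw.integral_dotProduct_mulVec]
  rw [Finset.sum_eq_single_of_mem i hi, if_pos rfl]
  intro j hj hji
  have hi' := Finset.mem_range.1 hi
  have hj' := Finset.mem_range.1 hj
  -- Both `i` and `j` are below `t`, so the truncated subtractions give distinct times.
  rw [if_neg (by omega)]

end WhiteNoise

/-! ### Impulse responses and the cost they carry. -/

namespace LQRSystem

open Matrix MeasureTheory Filter Topology

variable {n m : ℕ} (sys : LQRSystem n m)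

/-- The state responses `1, A + B U₀, …` to a unit impulse of the noise, when the input responds
by `U`. -/
def impulse (sys : LQRSystem n m) (U : ℕ → Matrix (Fin m) (Fin n) ℝ) : ℕ → Matrix (Fin n) (Fin n) ℝ
  | 0 => 1
  | i + 1 => sys.A * sys.impulse U i + sys.B * U i

/-- The input responses of a disturbance response controller. -/
def drcImpulse {H : ℕ} (L : Fin H → Matrix (Fin m) (Fin n) ℝ) (i : ℕ) :
    Matrix (Fin m) (Fin n) ℝ :=
  if h : i < H then L ⟨i, h⟩ else 0

/-- The stage cost summed over matching columns of `X` and `U`. -/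
noncomputable def matrixCost (X : Matrix (Fin n) (Fin n) ℝ) (U : Matrix (Fin m) (Fin n) ℝ) : ℝ :=
  (Xᵀ * sys.Q * X).trace + (Uᵀ * sys.R * U).trace + 2 * (Uᵀ * sys.S * X).trace

theorem matrixCost_eq_sum (X : Matrix (Fin n) (Fin n) ℝ) (U : Matrix (Fin m) (Fin n) ℝ) :
    sys.matrixCost X U = ∑ j, sys.stageCost (Xᵀ j) (Uᵀ j) := by
  simp only [matrixCost, stageCost, trace_transpose_mul_mul_eq_sum, Finset.sum_add_distrib,
    Finset.mul_sum]

theorem dotProduct_weight_mulVec (x : Fin n → ℝ) (u : Fin m → ℝ) :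
    Sum.elim x u ⬝ᵥ (sys.weight *ᵥ Sum.elim x u) = sys.stageCost x u := by
  have h : x ⬝ᵥ (sys.Sᵀ *ᵥ u) = u ⬝ᵥ (sys.S *ᵥ x) := by
    rw [dotProduct_mulVec, vecMul_transpose, dotProduct_comm]
  rw [weight, fromBlocks_mulVec, sumElim_dotProduct_sumElim, stageCost]
  simp only [Sum.elim_comp_inl, Sum.elim_comp_inr, dotProduct_add, h]
  ring

variable {sys}

/-- Supplies coercivity of the cost in the controller entries. -/
theorem exists_sq_le_matrixCost (hw : sys.weight.PosDef) :
    ∃ ε > 0, ∀ X U i j, ε * U i j ^ 2 ≤ sys.matrixCost X U := by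
  obtain ⟨ε, hε, h⟩ := hw.exists_sq_le_dotProduct_mulVec
  refine ⟨ε, hε, fun X U i j => ?_⟩
  have hj : ∀ j i, ε * U i j ^ 2 ≤ sys.stageCost (Xᵀ j) (Uᵀ j) := fun j i => by
    simpa [dotProduct_weight_mulVec] using h (Sum.elim (Xᵀ j) (Uᵀ j)) (Sum.inr i)
  rw [matrixCost_eq_sum]
  refine (hj j i).trans
    (Finset.single_le_sum (f := fun j => sys.stageCost (Xᵀ j) (Uᵀ j)) (fun j _ => ?_)
      (Finset.mem_univ j))
  exact le_trans (by positivity) (hj j i)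

theorem posDef_inputWeight (hw : sys.weight.PosDef) : sys.R.PosDef :=
  hw.submatrix Sum.inr_injective

theorem transpose_stateWeight (hw : sys.weight.PosDef) : sys.Qᵀ = sys.Q :=
  (hw.submatrix Sum.inl_injective).isHermitian

/-! ### The Riccati equation and the lower bound `tr P`. -/

section Riccati

variable {P : Matrix (Fin n) (Fin n) ℝ}

theorem IsCostToGo.posDef (hP : sys.IsCostToGo P) (hw : sys.weight.PosDef) :
    (sys.R + sys.Bᵀ * P * sys.B).PosDef :=
  (posDef_inputWeight hw).add_posSemidef (hP.1.conjTranspose_mul_mul_same sys.B)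

theorem IsCostToGo.mul_gain (hP : sys.IsCostToGo P) (hw : sys.weight.PosDef) :
    (sys.R + sys.Bᵀ * P * sys.B) * sys.gain P = -(sys.Bᵀ * P * sys.A + sys.S) := by
  rw [gain, Matrix.mul_neg,
    mul_nonsing_inv_cancel_left _ _ ((isUnit_iff_isUnit_det _).1 (hP.posDef hw).isUnit)]

theorem IsCostToGo.stateWeight_eq (hP : sys.IsCostToGo P) (hw : sys.weight.PosDef) :
    sys.Q = P - sys.Aᵀ * P * sys.A
      + (sys.gain P)ᵀ * (sys.R + sys.Bᵀ * P * sys.B) * sys.gain P := by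
  have hPt : Pᵀ = P := hP.1.isHermitian
  have hMt : (sys.R + sys.Bᵀ * P * sys.B)ᵀ = sys.R + sys.Bᵀ * P * sys.B :=
    (hP.posDef hw).isHermitian
  have h1 : (sys.gain P)ᵀ * (sys.R + sys.Bᵀ * P * sys.B)
      = -(sys.Aᵀ * P * sys.B + sys.Sᵀ) := by
    have h := congrArg transpose (hP.mul_gain hw)
    rw [transpose_mul, hMt] at h
    rw [h]
    simp [transpose_mul, hPt, Matrix.mul_assoc]
  rw [h1, gain, Matrix.neg_mul, Matrix.mul_neg, neg_neg, ← Matrix.mul_assoc]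
  have h2 := hP.2
  rw [← sub_eq_iff_eq_add'] at h2
  rw [← h2]
  abel

/-- Completion of the square through the Riccati equation. -/
theorem IsCostToGo.matrixCost_eq (hP : sys.IsCostToGo P) (hw : sys.weight.PosDef)
    (X : Matrix (Fin n) (Fin n) ℝ) (U : Matrix (Fin m) (Fin n) ℝ) :
    sys.matrixCost X U = (Xᵀ * P * X).trace
      - ((sys.A * X + sys.B * U)ᵀ * P * (sys.A * X + sys.B * U)).trace
      + ((U - sys.gain P * X)ᵀ * (sys.R + sys.Bᵀ * P * sys.B) * (U - sys.gain P * X)).trace := by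
  have hPt : Pᵀ = P := hP.1.isHermitian
  have hMt : (sys.R + sys.Bᵀ * P * sys.B)ᵀ = sys.R + sys.Bᵀ * P * sys.B :=
    (hP.posDef hw).isHermitian
  have hQ := hP.stateWeight_eq hw
  have hS := hP.mul_gain hw
  set M := sys.R + sys.Bᵀ * P * sys.B with hM
  set K := sys.gain P
  have hR : sys.R = M - sys.Bᵀ * P * sys.B := by rw [hM]; abel
  have hS' : sys.S = -(M * K) - sys.Bᵀ * P * sys.A := by rw [hS]; abel
  have e1 : (Xᵀ * (sys.Aᵀ * (P * (sys.B * U)))).trace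
      = (Uᵀ * (sys.Bᵀ * (P * (sys.A * X)))).trace := by
    rw [← trace_transpose]
    simp [transpose_mul, hPt, Matrix.mul_assoc]
  have e2 : (Xᵀ * (Kᵀ * (M * U))).trace = (Uᵀ * (M * (K * X))).trace := by
    rw [← trace_transpose]
    simp [transpose_mul, hMt, Matrix.mul_assoc]
  clear_value M K
  -- With `Q`, `R`, `S` eliminated, a polynomial identity in the remaining matrices is left; `e1`
  -- and `e2` identify cross terms that are transposes of each other.
  rw [matrixCost, hQ, hR, hS']
  simp only [transpose_add, transpose_sub, transpose_mul, Matrix.mul_add, Matrix.add_mul,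
    Matrix.mul_sub, Matrix.sub_mul, Matrix.mul_neg, Matrix.neg_mul, trace_add, trace_sub, trace_neg,
    Matrix.mul_assoc, e1, e2]
  ring

/-- The cost differences telescope from `tr P`, because the impulse response starts at `1`, down to
a boundary term that `h0` sends to zero. What remains is the total squared deviation from the
optimal feedback. -/
theorem IsCostToGo.tendsto_sum_trace (hP : sys.IsCostToGo P) (hw : sys.weight.PosDef)
    {U : ℕ → Matrix (Fin m) (Fin n) ℝ} {c : ℝ}
    (hc : HasSum (fun i => sys.matrixCost (sys.impulse U i) (U i)) c)
    (h0 : Tendsto (fun N => ((sys.impulse U N)ᵀ * P * sys.impulse U N).trace) atTop (𝓝 0)) :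
    Tendsto (fun N => ∑ i ∈ Finset.range N, ((U i - sys.gain P * sys.impulse U i)ᵀ
      * (sys.R + sys.Bᵀ * P * sys.B) * (U i - sys.gain P * sys.impulse U i)).trace) atTop
      (𝓝 (c - P.trace)) := by
  have h := (hc.tendsto_sum_nat.sub_const P.trace).add h0
  rw [add_zero] at h
  refine h.congr fun N => ?_
  have hN : ∑ i ∈ Finset.range N, (((sys.impulse U i)ᵀ * P * sys.impulse U i).trace
      - ((sys.impulse U (i + 1))ᵀ * P * sys.impulse U (i + 1)).trace)
      = P.trace - ((sys.impulse U N)ᵀ * P * sys.impulse U N).trace := by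
    rw [Finset.sum_range_sub' fun i => ((sys.impulse U i)ᵀ * P * sys.impulse U i).trace]
    simp [impulse]
  simp only [hP.matrixCost_eq hw, Finset.sum_add_distrib]
  simp only [impulse] at hN
  rw [hN]
  ring

theorem IsCostToGo.trace_le (hP : sys.IsCostToGo P) (hw : sys.weight.PosDef)
    {U : ℕ → Matrix (Fin m) (Fin n) ℝ} {c : ℝ}
    (hc : HasSum (fun i => sys.matrixCost (sys.impulse U i) (U i)) c)
    (h0 : Tendsto (fun N => ((sys.impulse U N)ᵀ * P * sys.impulse U N).trace) atTop (𝓝 0)) :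
    P.trace ≤ c := by
  refine sub_nonneg.1 (ge_of_tendsto' (hP.tendsto_sum_trace hw hc h0) fun N => ?_)
  exact Finset.sum_nonneg fun i _ =>
    ((hP.posDef hw).posSemidef.conjTranspose_mul_mul_same _).trace_nonneg

theorem IsCostToGo.eq_trace (hP : sys.IsCostToGo P) (hw : sys.weight.PosDef)
    {U : ℕ → Matrix (Fin m) (Fin n) ℝ} {c : ℝ}
    (hU : ∀ i, U i = sys.gain P * sys.impulse U i)
    (hc : HasSum (fun i => sys.matrixCost (sys.impulse U i) (U i)) c)
    (h0 : Tendsto (fun N => ((sys.impulse U N)ᵀ * P * sys.impulse U N).trace) atTop (𝓝 0)) :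
    c = P.trace := by
  refine sub_eq_zero.1 (tendsto_nhds_unique (hP.tendsto_sum_trace hw hc h0) ?_)
  simp [← hU]

end Riccati

/-! ### Controllers as linear filters of the noise. -/

section Responses

theorem mulVec_filterResponse {a b : ℕ} (K : Matrix (Fin b) (Fin a) ℝ)
    (F : ℕ → Matrix (Fin a) (Fin n) ℝ) (w : ℕ → Fin n → ℝ) (t : ℕ) :
    K *ᵥ filterResponse F w t = filterResponse (fun i => K * F i) w t := by
  simp only [filterResponse, mulVec_sum, mulVec_mulVec]

theorem filterResponse_succ {a : ℕ} (F : ℕ → Matrix (Fin a) (Fin n) ℝ) (w : ℕ → Fin n → ℝ)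
    (t : ℕ) : filterResponse F w (t + 1)
      = filterResponse (fun i => F (i + 1)) w t + F 0 *ᵥ w t := by
  rw [filterResponse, Finset.sum_range_succ']
  simp [filterResponse]

theorem state_eq_filterResponse (U : ℕ → Matrix (Fin m) (Fin n) ℝ) (w : ℕ → Fin n → ℝ) (t : ℕ) :
    sys.state (filterResponse U w) w t = filterResponse (sys.impulse U) w t := by
  induction t with
  | zero => simp [state, filterResponse]
  | succ t ih =>
    rw [state, ih, filterResponse_succ, mulVec_filterResponse, mulVec_filterResponse]
    simp [impulse, filterResponse, add_mulVec, Finset.sum_add_distrib]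

theorem feedbackState_eq_filterResponse (K : Matrix (Fin m) (Fin n) ℝ) (w : ℕ → Fin n → ℝ)
    (t : ℕ) : sys.feedbackState K w t
      = filterResponse (fun i => (sys.A + sys.B * K) ^ i) w t := by
  induction t with
  | zero => simp [feedbackState, filterResponse]
  | succ t ih =>
    rw [feedbackState, ih, filterResponse_succ, mulVec_mulVec, ← add_mulVec, mulVec_filterResponse]
    simp [pow_succ']

theorem drcInput_eq_filterResponse {H : ℕ} (L : Fin H → Matrix (Fin m) (Fin n) ℝ)
    (w : ℕ → Fin n → ℝ) : drcInput L w = filterResponse (drcImpulse L) w := by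
  funext t
  have h : drcInput L w t = ∑ i ∈ Finset.range H,
      if i < t then drcImpulse L i *ᵥ w (t - (i + 1)) else 0 := by
    rw [drcInput, Finset.sum_range]
    refine Finset.sum_congr rfl fun i _ => ?_
    simp [drcImpulse]
  rw [h, filterResponse, ← Finset.sum_filter]
  -- The controller sums over lags below `H` and discards those not below `t`; the filter sums over
  -- lags below `t` with zero coefficients from `H` on.
  have h2 : (Finset.range H).filter (· < t) = (Finset.range t).filter (· < H) := by
    ext i
    simp [and_comm]
  rw [h2, Finset.sum_filter]
  refine Finset.sum_congr rfl fun i _ => ?_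
  by_cases hi : i < H <;> simp [hi, drcImpulse]

theorem impulse_drcImpulse_add {H : ℕ} (L : Fin H → Matrix (Fin m) (Fin n) ℝ) (k : ℕ) :
    sys.impulse (drcImpulse L) (k + H) = sys.A ^ k * sys.impulse (drcImpulse L) H := by
  induction k with
  | zero => simp
  | succ k ih => rw [Nat.succ_add, impulse, ih, pow_succ', Matrix.mul_assoc]; simp [drcImpulse]

theorem impulse_feedback (K : Matrix (Fin m) (Fin n) ℝ) (i : ℕ) :
    sys.impulse (fun i => K * (sys.A + sys.B * K) ^ i) i = (sys.A + sys.B * K) ^ i := by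
  induction i with
  | zero => rfl
  | succ i ih => rw [impulse, ih, pow_succ', Matrix.add_mul, Matrix.mul_assoc]

theorem impulse_congr {U V : ℕ → Matrix (Fin m) (Fin n) ℝ} {H : ℕ} (h : ∀ i < H, U i = V i) :
    ∀ i ≤ H, sys.impulse U i = sys.impulse V i := by
  intro i
  induction i with
  | zero => exact fun _ => rfl
  | succ i ih => intro hi; rw [impulse, impulse, ih (by omega), h i hi]

end Responses

/-! ### The average cost as the sum of a series. -/

section AverageCost

variable {Ω : Type*} [MeasurableSpace Ω] {μ : Measure Ω} {w : ℕ → Ω → Fin n → ℝ}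

theorem tendsto_average_stageCost (hw : IsStandardNoise μ w)
    {F : ℕ → Matrix (Fin n) (Fin n) ℝ} {G : ℕ → Matrix (Fin m) (Fin n) ℝ} {c : ℝ}
    (hc : HasSum (fun i => sys.matrixCost (F i) (G i)) c) :
    Tendsto (fun T : ℕ => (1 / (T : ℝ)) * ∫ ω, ∑ t ∈ Finset.range T,
      sys.stageCost (filterResponse F (fun s => w s ω) t)
        (filterResponse G (fun s => w s ω) t) ∂μ) atTop (𝓝 c) := by
  have hQ := hw.integrable_filterResponse F F sys.Q
  have hR := hw.integrable_filterResponse G G sys.R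
  have hS := fun t => (hw.integrable_filterResponse G F sys.S t).const_mul 2
  have hQR : ∀ t, Integrable (fun ω =>
      filterResponse F (fun s => w s ω) t ⬝ᵥ (sys.Q *ᵥ filterResponse F (fun s => w s ω) t)
      + filterResponse G (fun s => w s ω) t ⬝ᵥ (sys.R *ᵥ filterResponse G (fun s => w s ω) t)) μ :=
    fun t => (hQ t).add (hR t)
  have hI : ∀ t, Integrable (fun ω => sys.stageCost (filterResponse F (fun s => w s ω) t)
      (filterResponse G (fun s => w s ω) t)) μ := fun t => (hQR t).add (hS t)
  have hE : ∀ t, ∫ ω, sys.stageCost (filterResponse F (fun s => w s ω) t)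
      (filterResponse G (fun s => w s ω) t) ∂μ
      = ∑ i ∈ Finset.range t, sys.matrixCost (F i) (G i) := by
    intro t
    simp only [stageCost]
    rw [integral_add (hQR t) (hS t), integral_add (hQ t) (hR t), integral_const_mul,
      hw.integral_filterResponse, hw.integral_filterResponse, hw.integral_filterResponse]
    simp only [matrixCost, Finset.sum_add_distrib, Finset.mul_sum]
  refine hc.tendsto_sum_nat.cesaro.congr fun T => ?_
  rw [integral_finsetSum _ fun t _ => hI t, one_div]
  simp only [hE]

theorem tendsto_drcAvgCost (hw : IsStandardNoise μ w) {H : ℕ}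
    {L : Fin H → Matrix (Fin m) (Fin n) ℝ} {c : ℝ}
    (hc : HasSum (fun i => sys.matrixCost (sys.impulse (drcImpulse L) i) (drcImpulse L i)) c) :
    Tendsto (sys.drcAvgCost μ w L) atTop (𝓝 c) := by
  refine (tendsto_average_stageCost hw hc).congr fun T => ?_
  simp only [drcAvgCost, drcInput_eq_filterResponse, state_eq_filterResponse]

theorem tendsto_feedbackAvgCost (hw : IsStandardNoise μ w) {K : Matrix (Fin m) (Fin n) ℝ} {c : ℝ}
    (hc : HasSum (fun i => sys.matrixCost ((sys.A + sys.B * K) ^ i)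
      (K * (sys.A + sys.B * K) ^ i)) c) :
    Tendsto (sys.feedbackAvgCost μ w K) atTop (𝓝 c) := by
  refine (tendsto_average_stageCost hw hc).congr fun T => ?_
  simp only [feedbackAvgCost, feedbackState_eq_filterResponse, mulVec_filterResponse]

end AverageCost

end LQRSystem

/-! ### Closed forms of the limit costs. -/

namespace LQRSystem

open Matrix MeasureTheory Filter Topology

variable {n m : ℕ} {sys : LQRSystem n m} {τ r : ℝ}

/-- The limit cost of a disturbance response controller, in closed form. -/
noncomputable def drcLimitCost (sys : LQRSystem n m) {H : ℕ}
    (L : Fin H → Matrix (Fin m) (Fin n) ℝ) : ℝ :=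
  ((sys.impulse (drcImpulse L) H)ᵀ * (∑' k : ℕ, (sys.A ^ k)ᵀ * sys.Q * sys.A ^ k)
      * sys.impulse (drcImpulse L) H).trace
    + ∑ i ∈ Finset.range H, sys.matrixCost (sys.impulse (drcImpulse L) i) (drcImpulse L i)

/-- From index `H` on the input response vanishes and the state response evolves by `A` alone, so
the tail is a Lyapunov series that does not depend on `L` except through the state response at `H`.
-/
theorem hasSum_drcLimitCost (hA : IsTauStable τ r sys.A) (hr0 : 0 ≤ r) (hr1 : r < 1) {H : ℕ}
    (L : Fin H → Matrix (Fin m) (Fin n) ℝ) :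
    HasSum (fun i => sys.matrixCost (sys.impulse (drcImpulse L) i) (drcImpulse L i))
      (sys.drcLimitCost L) := by
  rw [← hasSum_nat_add_iff' H, drcLimitCost, add_sub_cancel_right]
  refine (hA.hasSum_trace hr0 hr1 sys.Q (sys.impulse (drcImpulse L) H)).congr_fun fun k => ?_
  rw [impulse_drcImpulse_add]
  simp [matrixCost, drcImpulse]

theorem tendsto_trace_drc (hA : IsTauStable τ r sys.A) (hr0 : 0 ≤ r) (hr1 : r < 1) {H : ℕ}
    (L : Fin H → Matrix (Fin m) (Fin n) ℝ) (P : Matrix (Fin n) (Fin n) ℝ) :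
    Tendsto (fun N => ((sys.impulse (drcImpulse L) N)ᵀ * P * sys.impulse (drcImpulse L) N).trace)
      atTop (𝓝 0) := by
  rw [← tendsto_add_atTop_iff_nat H]
  simp only [impulse_drcImpulse_add]
  exact (hA.hasSum_trace hr0 hr1 P _).summable.tendsto_atTop_zero

theorem summable_feedback {K : Matrix (Fin m) (Fin n) ℝ}
    (hAK : IsTauStable τ r (sys.A + sys.B * K)) (hr0 : 0 ≤ r) (hr1 : r < 1) :
    Summable fun i => sys.matrixCost ((sys.A + sys.B * K) ^ i) (K * (sys.A + sys.B * K) ^ i) := by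
  have h := fun W => (hAK.hasSum_trace hr0 hr1 W 1).summable
  refine (((h sys.Q).add (h (Kᵀ * sys.R * K))).add ((h (Kᵀ * sys.S)).mul_left 2)).congr fun i => ?_
  simp only [matrixCost, transpose_mul, Matrix.mul_assoc, Matrix.mul_one]

theorem tendsto_trace_feedback {K : Matrix (Fin m) (Fin n) ℝ}
    (hAK : IsTauStable τ r (sys.A + sys.B * K)) (hr0 : 0 ≤ r) (hr1 : r < 1)
    (P : Matrix (Fin n) (Fin n) ℝ) :
    Tendsto (fun i => (((sys.A + sys.B * K) ^ i)ᵀ * P * (sys.A + sys.B * K) ^ i).trace)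
      atTop (𝓝 0) := by
  simpa using (hAK.hasSum_trace hr0 hr1 P 1).summable.tendsto_atTop_zero

theorem IsCostToGo.hasSum_feedback {P : Matrix (Fin n) (Fin n) ℝ} (hP : sys.IsCostToGo P)
    (hw : sys.weight.PosDef) (hAK : IsTauStable τ r (sys.A + sys.B * sys.gain P)) (hr0 : 0 ≤ r)
    (hr1 : r < 1) :
    HasSum (fun i => sys.matrixCost ((sys.A + sys.B * sys.gain P) ^ i)
      (sys.gain P * (sys.A + sys.B * sys.gain P) ^ i)) P.trace := by
  have h := (summable_feedback hAK hr0 hr1).hasSum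
  have h' := hP.eq_trace hw (U := fun i => sys.gain P * (sys.A + sys.B * sys.gain P) ^ i)
    (fun i => by rw [impulse_feedback]) (by simpa only [impulse_feedback] using h)
    (by simpa only [impulse_feedback] using tendsto_trace_feedback hAK hr0 hr1 P)
  rwa [h'] at h

/-! ### Existence of an optimal disturbance response controller. -/

section Minimizer

variable {H : ℕ}

theorem continuous_drcImpulse (i : ℕ) :
    Continuous fun L : Fin H → Matrix (Fin m) (Fin n) ℝ => drcImpulse L i := by
  by_cases h : i < H
  · simpa only [drcImpulse, h, dite_true] using continuous_apply _
  · simpa only [drcImpulse, h, dite_false] using continuous_const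

theorem continuous_impulse (i : ℕ) :
    Continuous fun L : Fin H → Matrix (Fin m) (Fin n) ℝ => sys.impulse (drcImpulse L) i := by
  induction i with
  | zero => exact continuous_const
  | succ i ih =>
    simp only [impulse]
    exact (continuous_const.matrix_mul ih).add
      (continuous_const.matrix_mul (continuous_drcImpulse i))

theorem continuous_drcLimitCost :
    Continuous fun L : Fin H → Matrix (Fin m) (Fin n) ℝ => sys.drcLimitCost L := by
  have hX := continuous_impulse (sys := sys) (H := H)
  have hU := continuous_drcImpulse (m := m) (n := n) (H := H)
  refine (((hX H).matrix_transpose.matrix_mul continuous_const).matrix_mul (hX H)).matrix_trace.add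
    (continuous_finsetSum _ fun i _ => ?_)
  exact (((((hX i).matrix_transpose.matrix_mul continuous_const).matrix_mul (hX i)).matrix_trace).add
    (((hU i).matrix_transpose.matrix_mul continuous_const).matrix_mul (hU i)).matrix_trace).add
    (continuous_const.mul
      (((hU i).matrix_transpose.matrix_mul continuous_const).matrix_mul (hX i)).matrix_trace)

theorem exists_forall_drcLimitCost_le (hw : sys.weight.PosDef) (hA : IsTauStable τ r sys.A)
    (hr0 : 0 ≤ r) (hr1 : r < 1) :
    ∃ L : Fin H → Matrix (Fin m) (Fin n) ℝ,
      ∀ L' : Fin H → Matrix (Fin m) (Fin n) ℝ, sys.drcLimitCost L ≤ sys.drcLimitCost L' := by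
  obtain ⟨ε, hε, hbound⟩ := exists_sq_le_matrixCost hw
  have hnonneg : ∀ X U, 0 ≤ sys.matrixCost X U := fun X U => by
    rw [matrixCost_eq_sum]
    refine Finset.sum_nonneg fun j _ => ?_
    rw [← dotProduct_weight_mulVec]
    simpa using hw.posSemidef.dotProduct_mulVec_nonneg (Sum.elim (Xᵀ j) (Uᵀ j))
  have hcoer : ∀ (L : Fin H → Matrix (Fin m) (Fin n) ℝ) h i j,
      ε * L h i j ^ 2 ≤ sys.drcLimitCost L := by
    intro L h i j
    have h1 := (hasSum_drcLimitCost hA hr0 hr1 L).summable.le_tsum (h : ℕ)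
      fun _ _ => hnonneg _ _
    rw [(hasSum_drcLimitCost hA hr0 hr1 L).tsum_eq] at h1
    refine le_trans ?_ h1
    simpa [drcImpulse] using
      hbound (sys.impulse (drcImpulse L) h) (drcImpulse L h) i j
  set c := sys.drcLimitCost (0 : Fin H → Matrix (Fin m) (Fin n) ℝ)
  have hc0 : 0 ≤ c := (hasSum_drcLimitCost hA hr0 hr1 _).nonneg fun _ => hnonneg _ _
  -- A controller no costlier than zero has squared entries at most `c / ε`, and `y ≤ (y + 1) ^ 2`
  -- for `y ≥ 0` gives a bound on the entries without square roots.
  let b : Fin H → Fin m → Fin n → ℝ := fun _ _ _ => c / ε + 1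
  have hb0 : 0 ≤ c / ε := by positivity
  have hmem : ∀ L : Fin H → Fin m → Fin n → ℝ, sys.drcLimitCost L ≤ c → L ∈ Set.Icc (-b) b := by
    intro L hL
    have habs : ∀ h i j, |L h i j| ≤ c / ε + 1 := by
      intro h i j
      have h1 : L h i j ^ 2 ≤ c / ε := by
        rw [le_div_iff₀ hε, mul_comm]
        exact (hcoer L h i j).trans hL
      exact abs_le_of_sq_le_sq (by nlinarith) (by linarith)
    exact ⟨fun h i j => (abs_le.1 (habs h i j)).1, fun h i j => (abs_le.1 (habs h i j)).2⟩
  have hcont : Continuous fun L : Fin H → Fin m → Fin n → ℝ => sys.drcLimitCost L :=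
    continuous_drcLimitCost
  obtain ⟨L, -, hL⟩ := (isCompact_Icc (a := -b) (b := b)).exists_isMinOn
    ⟨0, hmem 0 le_rfl⟩ hcont.continuousOn
  refine ⟨L, fun L' => ?_⟩
  by_cases h : sys.drcLimitCost L' ≤ c
  · exact hL (hmem L' h)
  · exact (hL (hmem 0 le_rfl)).trans (not_le.1 h).le

end Minimizer

/-! ### The excess cost of the truncated optimal feedback. -/

section Truncation

variable {K : Matrix (Fin m) (Fin n) ℝ}

/-- Cost of the state `X` without input against that of the state `Y` under feedback. -/
theorem matrixCost_sub_matrixCost_le (hQ : sys.Qᵀ = sys.Q) (hR : sys.R.PosSemidef)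
    (X Y : Matrix (Fin n) (Fin n) ℝ) :
    sys.matrixCost X 0 - sys.matrixCost Y (K * Y)
      ≤ n * (‖X - Y‖ * ‖sys.Q‖ * ‖X + Y‖) + 2 * (n * (‖K * Y‖ * ‖sys.S‖ * ‖Y‖)) := by
  have h1 := trace_transpose_mul_mul_le (X - Y) sys.Q (X + Y)
  have h2 := trace_transpose_mul_mul_le (-(K * Y)) sys.S Y
  -- The input cost of the feedback enters with a minus sign and is dropped, so `R` contributes
  -- nothing to the bound.
  have h3 : 0 ≤ ((K * Y)ᵀ * sys.R * (K * Y)).trace :=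
    (hR.conjTranspose_mul_mul_same (K * Y)).trace_nonneg
  have h4 : (Yᵀ * sys.Q * X).trace = (Xᵀ * sys.Q * Y).trace := by
    rw [← trace_transpose]
    simp [transpose_mul, hQ, Matrix.mul_assoc]
  -- Difference of squares: symmetry of `Q` makes the cross terms cancel, leaving one small factor
  -- `X - Y`.
  have h5 : ((X - Y)ᵀ * sys.Q * (X + Y)).trace
      = (Xᵀ * sys.Q * X).trace - (Yᵀ * sys.Q * Y).trace := by
    simp only [transpose_sub, Matrix.sub_mul, Matrix.mul_add, trace_sub, trace_add, h4]
    ring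
  rw [h5] at h1
  rw [norm_neg, transpose_neg, Matrix.neg_mul, Matrix.neg_mul, trace_neg] at h2
  have h6 : sys.matrixCost X 0 = (Xᵀ * sys.Q * X).trace := by simp [matrixCost]
  rw [h6, matrixCost]
  linarith

theorem matrixCost_truncated_sub_le (hQ : sys.Qᵀ = sys.Q) (hR : sys.R.PosSemidef)
    (hA : IsTauStable τ r sys.A) (hAK : IsTauStable τ r (sys.A + sys.B * K)) (hr0 : 0 < r)
    (H k : ℕ) :
    sys.matrixCost (sys.A ^ k * (sys.A + sys.B * K) ^ H) 0
        - sys.matrixCost ((sys.A + sys.B * K) ^ (k + H)) (K * (sys.A + sys.B * K) ^ (k + H))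
      ≤ 2 * n * τ ^ 4 * (r ^ 2) ^ H * ‖K‖ *
        (‖sys.B‖ * ‖sys.Q‖ / r * (k * (r ^ 2) ^ k) + ‖sys.S‖ * (r ^ 2) ^ k) := by
  set C := sys.A + sys.B * K with hC
  have hτ := hA.nonneg
  have hY : ‖C ^ (k + H)‖ ≤ τ ^ 2 * r ^ (k + H) := hAK.norm_pow_le_sq_mul _
  have hX : ‖sys.A ^ k * C ^ H‖ ≤ τ ^ 2 * r ^ (k + H) := by
    refine (norm_mul_le _ _).trans ((mul_le_mul (hA k) (hAK H) (norm_nonneg _)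
      (by positivity)).trans (le_of_eq (by ring)))
  have hsum : ‖sys.A ^ k * C ^ H + C ^ (k + H)‖ ≤ 2 * τ ^ 2 * r ^ (k + H) :=
    (norm_add_le _ _).trans (by linarith)
  have hBK : ‖sys.A - C‖ ≤ ‖sys.B‖ * ‖K‖ := by
    rw [hC, sub_add_cancel_left, norm_neg]
    exact l2_opNorm_mul _ _
  have hdiff : ‖sys.A ^ k * C ^ H - C ^ (k + H)‖
      ≤ k * (τ ^ 2 * (‖sys.B‖ * ‖K‖) * r ^ (k + H)) / r := by
    rw [pow_add C, ← sub_mul, le_div_iff₀ hr0, mul_comm _ r]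
    refine (hA.norm_pow_sub_pow_mul_pow_le hAK hr0.le k H).trans ?_
    gcongr
  have hKY : ‖K * C ^ (k + H)‖ ≤ ‖K‖ * (τ ^ 2 * r ^ (k + H)) :=
    (l2_opNorm_mul _ _).trans (mul_le_mul_of_nonneg_left hY (norm_nonneg _))
  refine (matrixCost_sub_matrixCost_le hQ hR _ _).trans ?_
  have e1 : ‖sys.A ^ k * C ^ H - C ^ (k + H)‖ * ‖sys.Q‖ * ‖sys.A ^ k * C ^ H + C ^ (k + H)‖
      ≤ k * (τ ^ 2 * (‖sys.B‖ * ‖K‖) * r ^ (k + H)) / r * ‖sys.Q‖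
        * (2 * τ ^ 2 * r ^ (k + H)) := by gcongr
  have e2 : ‖K * C ^ (k + H)‖ * ‖sys.S‖ * ‖C ^ (k + H)‖
      ≤ ‖K‖ * (τ ^ 2 * r ^ (k + H)) * ‖sys.S‖ * (τ ^ 2 * r ^ (k + H)) := by gcongr
  calc _ ≤ n * (k * (τ ^ 2 * (‖sys.B‖ * ‖K‖) * r ^ (k + H)) / r * ‖sys.Q‖
          * (2 * τ ^ 2 * r ^ (k + H)))
        + 2 * (n * (‖K‖ * (τ ^ 2 * r ^ (k + H)) * ‖sys.S‖ * (τ ^ 2 * r ^ (k + H)))) := by gcongr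
    _ = _ := by ring

/-- The limit cost of the feedback `K` truncated to order `H` exceeds that of `K` by `O(r ^ 2H)`. -/
theorem drcLimitCost_truncated_sub_le (hQ : sys.Qᵀ = sys.Q) (hR : sys.R.PosSemidef)
    (hA : IsTauStable τ r sys.A) (hAK : IsTauStable τ r (sys.A + sys.B * K)) (hr0 : 0 < r)
    (hr1 : r < 1) {c : ℝ}
    (hc : HasSum (fun i => sys.matrixCost ((sys.A + sys.B * K) ^ i)
      (K * (sys.A + sys.B * K) ^ i)) c) (H : ℕ) :
    sys.drcLimitCost (fun h : Fin H => K * (sys.A + sys.B * K) ^ (h : ℕ)) - c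
      ≤ 2 * n * τ ^ 4 * (r ^ 2) ^ H * ‖K‖ *
        (‖sys.B‖ * ‖sys.Q‖ / r * (r ^ 2 / (1 - r ^ 2) ^ 2) + ‖sys.S‖ * (1 - r ^ 2)⁻¹) := by
  set C := sys.A + sys.B * K with hC
  set L : Fin H → Matrix (Fin m) (Fin n) ℝ := fun h => K * C ^ (h : ℕ)
  have hU : ∀ i < H, drcImpulse L i = K * C ^ i := fun i hi => by simp [drcImpulse, hi, L]
  have hX : ∀ i ≤ H, sys.impulse (drcImpulse L) i = C ^ i := fun i hi => by
    rw [impulse_congr (V := fun i => K * C ^ i) hU i hi, impulse_feedback]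
  have hd := (hasSum_nat_add_iff' H).2 ((hasSum_drcLimitCost hA hr0.le hr1 L).sub hc)
  have hzero : ∑ i ∈ Finset.range H, (sys.matrixCost (sys.impulse (drcImpulse L) i)
      (drcImpulse L i) - sys.matrixCost (C ^ i) (K * C ^ i)) = 0 :=
    Finset.sum_eq_zero fun i hi => by
      have hi' := Finset.mem_range.1 hi
      rw [hU i hi', hX i hi'.le, sub_self]
  rw [hzero, sub_zero] at hd
  have hq : ‖r ^ 2‖ < 1 := by
    rw [Real.norm_of_nonneg (by positivity)]
    nlinarith
  have hb := (((hasSum_coe_mul_geometric_of_norm_lt_one hq).mul_left (‖sys.B‖ * ‖sys.Q‖ / r)).add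
    ((hasSum_geometric_of_norm_lt_one hq).mul_left ‖sys.S‖)).mul_left
      (2 * n * τ ^ 4 * (r ^ 2) ^ H * ‖K‖)
  refine hasSum_le (fun k => ?_) hd hb
  rw [impulse_drcImpulse_add, hX H le_rfl,
    show drcImpulse L (k + H) = 0 by simp [drcImpulse]]
  exact matrixCost_truncated_sub_le hQ hR hA hAK hr0 H k

/-- Pure slack: `n ≤ n ^ 2` in the naturals, `r` and `1 - r ^ 2` are at most `1`, `2 ≤ 4`, `K ≤ B K
^ 2 + K`, and `R ≥ 0` is added. -/
theorem truncation_bound_le {n : ℕ} {τ r R S B Q K E : ℝ} (hr0 : 0 < r) (hr1 : r < 1)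
    (hR : 0 ≤ R) (hS : 0 ≤ S) (hB : 0 ≤ B) (hQ : 0 ≤ Q) (hK : 0 ≤ K) (hE : 0 ≤ E) :
    2 * n * τ ^ 4 * E * K * (B * Q / r * (r ^ 2 / (1 - r ^ 2) ^ 2) + S * (1 - r ^ 2)⁻¹)
      ≤ (n : ℝ) ^ 2 * E * (R + 4 * τ ^ 4 * (B * K ^ 2 + K) * (B * Q + S) / (1 - r ^ 2) ^ 3) := by
  have hD0 : 0 < 1 - r ^ 2 := by nlinarith
  have hD1 : 1 - r ^ 2 ≤ 1 := by nlinarith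
  have hn : (n : ℝ) ≤ (n : ℝ) ^ 2 := by exact_mod_cast Nat.le_self_pow two_ne_zero n
  set D := 1 - r ^ 2
  have h1 : B * Q / r * (r ^ 2 / D ^ 2) ≤ B * Q / D ^ 3 := by
    have hrr : B * Q / r * (r ^ 2 / D ^ 2) = r * D * (B * Q / D ^ 3) := by field_simp
    rw [hrr]
    exact mul_le_of_le_one_left (by positivity) (mul_le_one₀ hr1.le hD0.le hD1)
  have h2 : S * D⁻¹ ≤ S / D ^ 3 := by
    have hrr : S * D⁻¹ = D ^ 2 * (S / D ^ 3) := by field_simp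
    rw [hrr]
    exact mul_le_of_le_one_left (by positivity) (pow_le_one₀ hD0.le hD1)
  calc _ ≤ 2 * (n : ℝ) ^ 2 * τ ^ 4 * E * K * (B * Q / D ^ 3 + S / D ^ 3) := by gcongr
    _ = (n : ℝ) ^ 2 * E * (2 * τ ^ 4 * K * (B * Q + S) / D ^ 3) := by ring
    _ ≤ (n : ℝ) ^ 2 * E * (4 * τ ^ 4 * (B * K ^ 2 + K) * (B * Q + S) / D ^ 3) := by
        have hBK : 0 ≤ B * K ^ 2 := by positivity
        gcongr
        · norm_num
        · linarith
    _ ≤ _ := by gcongr; linarith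

end Truncation

end LQRSystem

/-! ### The main theorem. -/

open LQRSystem

theorem mainTheorem2 {n m : ℕ} (sys : LQRSystem n m)
    {Ω : Type*} [MeasurableSpace Ω] (μ : MeasureTheory.Measure Ω)
    [MeasureTheory.IsProbabilityMeasure μ] (w : ℕ → Ω → Fin n → ℝ) (hw : IsStandardNoise μ w)
    (hweight : sys.weight.PosDef)
    (P : Matrix (Fin n) (Fin n) ℝ) (hP : sys.IsCostToGo P)
    (K : Matrix (Fin m) (Fin n) ℝ) (hK : K = sys.gain P)
    (τ ρ : ℝ) (hρ : 0 < ρ)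
    (hA : IsTauStable τ (Real.exp (-ρ)) sys.A)
    (hAK : IsTauStable τ (Real.exp (-ρ)) (sys.A + sys.B * K)) :
    Filter.Tendsto (sys.feedbackAvgCost μ w K) Filter.atTop (nhds (sys.feedbackCost μ w K)) ∧
    ∀ H : ℕ,
      (∀ L : Fin H → Matrix (Fin m) (Fin n) ℝ,
        Filter.Tendsto (sys.drcAvgCost μ w L) Filter.atTop (nhds (sys.drcCost μ w L))) ∧
      (∃ L : Fin H → Matrix (Fin m) (Fin n) ℝ, sys.IsOptimalDRC μ w L) ∧
      ∀ L : Fin H → Matrix (Fin m) (Fin n) ℝ, sys.IsOptimalDRC μ w L →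
        0 ≤ sys.drcCost μ w L - sys.feedbackCost μ w K ∧
        sys.drcCost μ w L - sys.feedbackCost μ w K ≤
          (n : ℝ) ^ 2 * Real.exp (-2 * ρ * H) *
            (‖sys.R‖ + 4 * τ ^ 4 * (‖sys.B‖ * ‖K‖ ^ 2 + ‖K‖) * (‖sys.B‖ * ‖sys.Q‖ + ‖sys.S‖)
              / (1 - Real.exp (-2 * ρ)) ^ 3) := by
  have hr0 : 0 < Real.exp (-ρ) := Real.exp_pos _
  have hr1 : Real.exp (-ρ) < 1 := by simpa using hρ
  subst hK
  have hfb := hP.hasSum_feedback hweight hAK hr0.le hr1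
  have hK := tendsto_feedbackAvgCost hw hfb
  have hKc : sys.feedbackCost μ w (sys.gain P) = P.trace := hK.limUnder_eq
  refine ⟨hKc ▸ hK, fun H => ?_⟩
  have hL := fun L : Fin H → Matrix (Fin m) (Fin n) ℝ =>
    tendsto_drcAvgCost hw (hasSum_drcLimitCost hA hr0.le hr1 L)
  have hLc : ∀ L : Fin H → Matrix (Fin m) (Fin n) ℝ, sys.drcCost μ w L = sys.drcLimitCost L :=
    fun L => (hL L).limUnder_eq
  refine ⟨fun L => hLc L ▸ hL L, ?_, fun L hopt => ⟨?_, ?_⟩⟩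
  · obtain ⟨L, hmin⟩ := exists_forall_drcLimitCost_le (H := H) hweight hA hr0.le hr1
    exact ⟨L, fun L' => by rw [hLc, hLc]; exact hmin L'⟩
  · rw [hLc, hKc, sub_nonneg]
    exact hP.trace_le hweight (hasSum_drcLimitCost hA hr0.le hr1 L)
      (tendsto_trace_drc hA hr0.le hr1 L P)
  · have hQ := transpose_stateWeight hweight
    have hR := (posDef_inputWeight hweight).posSemidef
    have hsq : Real.exp (-2 * ρ) = Real.exp (-ρ) ^ 2 := by
      rw [← Real.exp_nat_mul]
      congr 1
      push_cast
      ring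
    have hpow : Real.exp (-2 * ρ * H) = (Real.exp (-ρ) ^ 2) ^ H := by
      rw [← hsq, ← Real.exp_nat_mul, mul_comm]
    rw [hsq, hpow, hKc]
    -- The competitor left implicit in `hopt` is the truncated feedback `K (A + B K) ^ h`, `h < H`.
    refine (sub_le_sub_right ((hopt _).trans (hLc _).le) _).trans
      ((drcLimitCost_truncated_sub_le hQ hR hA hAK hr0 hr1 hfb H).trans ?_)
    exact truncation_bound_le hr0 hr1 (norm_nonneg _) (norm_nonneg _) (norm_nonneg _)
      (norm_nonneg _) (norm_nonneg _) (by positivity)
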